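/- Let $k, m \ge 1$ be integers, let $n = 2km$ (so $m = n/2k$), $\theta = \pi/k$ and $\delta = n^{-4}$. For $i = 1, \dots, m$ let $x_i^+ = (1/2, i\delta)$ and $x_i^- = (-1/2, i\delta)$ in $\mathbb{R}^2$, and let $S_0 = \{x_1^+, \dots, x_m^+, x_1^-, \dots, x_m^-\}$. For $j = 1, \dots, k-1$ let $S_j$ be the set obtained by rotating $S_0$ about the origin by the angle $j\theta$, and let $S = S_0 \cup \dots \cup S_{k-1}$. Let $\mathcal{R}_1(S)$ be the Vietoris–Rips complex of $S$ at scale $1$, that is, the abstract simplicial complex whose simplices are the nonempty finite subsets of $S$ whose points are pairwise at Euclidean distance at most $1$. Then, over any field $\mathbb{F}$, the $(2k-1)$-th Betti number $\beta_{2k-1}(S) = \dim_{\mathbb{F}} H_{2k-1}(\mathcal{R}_1(S); \mathbb{F})$ is $$\beta_{2k-1}(S) = (m-1)^k = \left(\frac{n}{2k} - 1\right)^k .$$ -/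

import Mathlib

noncomputable section

/-- The Vietoris–Rips complex at scale `ε` of a set `S` of points of a metric space: its simplices
are the nonempty finite subsets of `S` whose points are pairwise within distance `ε`. -/
def ripsComplex {X : Type*} [PseudoMetricSpace X] (ε : ℝ) (S : Set X) :
    PreAbstractSimplicialComplex X where
  faces := {s | s.Nonempty ∧ (s : Set X) ⊆ S ∧ ∀ x ∈ s, ∀ y ∈ s, dist x y ≤ ε}
  isRelLowerSet_faces := fun _ hs => ⟨hs.1, fun _ hts ht =>
    ⟨ht, fun _ hx => hs.2.1 (hts hx), fun x hx y hy => hs.2.2 x (hts hx) y (hts hy)⟩⟩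

/-- The quotient `Z / B` of two subspaces `B ≤ Z` of a vector space. -/
def Subquotient {F M : Type*} [Field F] [AddCommGroup M] [Module F M] (Z B : Submodule F M) :
    Type _ :=
  Z ⧸ B.submoduleOf Z

instance {F M : Type*} [Field F] [AddCommGroup M] [Module F M] (Z B : Submodule F M) :
    AddCommGroup (Subquotient Z B) :=
  inferInstanceAs (AddCommGroup (Z ⧸ B.submoduleOf Z))

instance {F M : Type*} [Field F] [AddCommGroup M] [Module F M] (Z B : Submodule F M) :
    Module F (Subquotient Z B) :=
  inferInstanceAs (Module F (Z ⧸ B.submoduleOf Z))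

namespace PreAbstractSimplicialComplex

section Homology

universe u v

variable {V : Type u}

/-- The `i`-simplices of a complex: the faces with `i + 1` vertices. -/
def Simplex (K : PreAbstractSimplicialComplex V) (i : ℕ) : Type u :=
  {s : Finset V // s ∈ K.faces ∧ s.card = i + 1}

/-- The `i`-chains of a complex: formal linear combinations of its `i`-simplices. -/
abbrev Chain (F : Type v) [Field F] (K : PreAbstractSimplicialComplex V) (i : ℕ) :
    Type (max u v) :=
  K.Simplex i →₀ F

variable [LinearOrder V]

/-- The face of an `(i+1)`-simplex `s` opposite to the vertex `v` of `s`. -/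
def Simplex.face {K : PreAbstractSimplicialComplex V} {i : ℕ} (s : K.Simplex (i + 1))
    (v : {v : V // v ∈ s.1}) : K.Simplex i :=
  ⟨s.1.erase v.1, by
    have hc : (s.1.erase v.1).card = i + 1 := by
      rw [Finset.card_erase_of_mem v.2, s.2.2]; rfl
    exact ⟨(K.isRelLowerSet_faces s.2.1).2 (Finset.erase_subset _ _)
      (Finset.card_pos.mp (by omega)), hc⟩⟩

/-- The boundary map from `(i+1)`-chains to `i`-chains. A simplex is oriented by listing its
vertices in increasing order, `v₀ < v₁ < ⋯`, so the position of a vertex `v` in this list is the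
number of vertices smaller than `v`, and `v` is removed with the sign `(-1) ^ position`. -/
def boundary (F : Type v) [Field F] (K : PreAbstractSimplicialComplex V) (i : ℕ) :
    Chain F K (i + 1) →ₗ[F] Chain F K i :=
  Finsupp.linearCombination F fun s : K.Simplex (i + 1) =>
    ∑ v ∈ s.1.attach, Finsupp.single (s.face v) ((-1 : F) ^ {u ∈ s.1 | u < v.1}.card)

/-- The `i`-cycles: the kernel of the boundary map on `i`-chains (which is zero on `0`-chains). -/
def cycles (F : Type v) [Field F] (K : PreAbstractSimplicialComplex V) :
    (i : ℕ) → Submodule F (Chain F K i)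
  | 0 => ⊤
  | i + 1 => LinearMap.ker (boundary F K i)

/-- The `i`-boundaries: the image of the boundary map on `(i+1)`-chains. -/
def boundaries (F : Type v) [Field F] (K : PreAbstractSimplicialComplex V) (i : ℕ) :
    Submodule F (Chain F K i) :=
  LinearMap.range (boundary F K i)

/-- The boundary of a boundary is zero. -/
theorem boundary_boundary (F : Type v) [Field F] (K : PreAbstractSimplicialComplex V) (i : ℕ) :
    boundary F K i ∘ₗ boundary F K (i + 1) = 0 := by
  refine Finsupp.lhom_ext' fun s => LinearMap.ext_ring ?_
  simp only [LinearMap.comp_apply, Finsupp.lsingle_apply, boundary,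
    Finsupp.linearCombination_single, one_smul, map_sum, LinearMap.zero_apply]
  simp only [Finset.smul_sum, Finsupp.smul_single, smul_eq_mul]
  rw [Finset.sum_sigma']
  refine Finset.sum_involution
    (fun p _ => ⟨⟨p.2.1, Finset.mem_of_mem_erase p.2.2⟩,
      ⟨p.1.1, Finset.mem_erase.mpr ⟨(Finset.ne_of_mem_erase p.2.2).symm, p.1.2⟩⟩⟩) ?_ ?_ ?_ ?_
  · rintro ⟨⟨v, hv⟩, ⟨w, hw⟩⟩ -
    have hwv : w ≠ v := Finset.ne_of_mem_erase hw
    have hws : w ∈ s.1 := Finset.mem_of_mem_erase hw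
    have hface : Simplex.face (s.face ⟨w, hws⟩)
        ⟨v, Finset.mem_erase.mpr ⟨hwv.symm, hv⟩⟩ = (s.face ⟨v, hv⟩).face ⟨w, hw⟩ :=
      Subtype.ext (Finset.erase_right_comm)
    have key : ∀ a b : V, a ∈ s.1 → a < b →
        {u ∈ s.1.erase a | u < b}.card + 1 = {u ∈ s.1 | u < b}.card := by
      intro a b ha hab
      rw [Finset.filter_erase, Finset.card_erase_add_one]
      exact Finset.mem_filter.mpr ⟨ha, hab⟩
    have key' : ∀ a b : V, b < a →
        {u ∈ s.1.erase a | u < b} = {u ∈ s.1 | u < b} := by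
      intro a b hab
      rw [Finset.filter_erase, Finset.erase_eq_of_notMem]
      simp [hab.le]
    dsimp only
    rw [hface, ← Finsupp.single_add, Finsupp.single_eq_zero]
    change (-1 : F) ^ {u ∈ s.1 | u < v}.card * (-1) ^ {u ∈ s.1.erase v | u < w}.card +
      (-1 : F) ^ {u ∈ s.1 | u < w}.card * (-1) ^ {u ∈ s.1.erase w | u < v}.card = 0
    rcases lt_or_gt_of_ne hwv with h | h
    · rw [key' v w h, ← key w v hws h]; ring
    · rw [key' w v h, ← key v w hv h]; ring
  · rintro ⟨⟨v, hv⟩, ⟨w, hw⟩⟩ - - h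
    have : w = v := congrArg (fun p => p.1.1) h
    exact Finset.ne_of_mem_erase hw this
  · intro p _
    simp
  · intro p _
    rfl

/-- The boundaries are cycles. -/
theorem boundaries_le_cycles (F : Type v) [Field F] (K : PreAbstractSimplicialComplex V) :
    ∀ i : ℕ, boundaries F K i ≤ cycles F K i
  | 0 => le_top
  | i + 1 => LinearMap.range_le_ker_iff.mpr (boundary_boundary F K i)

/-- The `i`-th simplicial homology with coefficients in `F`: cycles modulo boundaries. -/
abbrev Homology (F : Type v) [Field F] (K : PreAbstractSimplicialComplex V) (i : ℕ) : Type (max u v) :=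
  Subquotient (cycles F K i) (boundaries F K i)

/-- The `i`-th Betti number: the dimension of the `i`-th homology. -/
def betti (F : Type v) [Field F] (K : PreAbstractSimplicialComplex V) (i : ℕ) : ℕ :=
  Module.finrank F (Homology F K i)

end Homology

end PreAbstractSimplicialComplex

/-- The rotation of the plane about the origin by the angle `φ`. -/
def planeRotation (φ : ℝ) (p : EuclideanSpace ℝ (Fin 2)) : EuclideanSpace ℝ (Fin 2) :=
  !₂[Real.cos φ * p 0 - Real.sin φ * p 1, Real.sin φ * p 0 + Real.cos φ * p 1]

/-- The `2m` points `(1/2, iδ)` and `(-1/2, iδ)`, for `1 ≤ i ≤ m`. -/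
def basePoints (m : ℕ) (δ : ℝ) : Set (EuclideanSpace ℝ (Fin 2)) :=
  {p | ∃ i : ℕ, 1 ≤ i ∧ i ≤ m ∧ (p = !₂[1 / 2, i * δ] ∨ p = !₂[-1 / 2, i * δ])}

/-- The union, over `0 ≤ j < k`, of the base points rotated by the angle `jπ/k`. -/
def rotatedPoints (k m : ℕ) (δ : ℝ) : Set (EuclideanSpace ℝ (Fin 2)) :=
  {q | ∃ j : ℕ, j < k ∧ q ∈ planeRotation (j * (Real.pi / k)) '' basePoints m δ}

end

/-!
The points form `k` blocks, one for each rotation angle. Within a block, two points on the same side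
are close, and two points on opposite sides are at distance at most `1` only if they have the same
height. Points of different blocks are always at distance at most `1`
(`dist_rotatedPoint_le_one_iff`): the rotation angles differ modulo `π` by at least `π / k`, and this
outweighs the tiny heights. So the Rips complex is the join of `k` copies of the complex `A` made of
two `(m - 1)`-simplices and `m` edges that match their vertices, a complex homotopy equivalent to a
wedge of `m - 1` circles.

The Künneth formula for the join is replaced by an explicit acyclic subcomplex. The simplices whose
part in every block is a connecting edge other than the lowest one are maximal, have dimension
`2k - 1`, and number `(m - 1) ^ k` (`edgeFace`). All the other simplices, together with the
empty one, form an acyclic complex (`acyclic_edgeFreeFaces`). It is built block by block: first come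
the simplices whose part in the block lies in the closed star of the lowest point on one side, and
they pair off by toggling this point; then come those whose part lies on the other side, and they
pair off by toggling the lowest point of that side. Simplices that pair off in this way preserve
acyclicity when they are added (`FinsetChain.Acyclic.of_toggle`). As the rest is acyclic, the homology
in dimension `2k - 1` is the space of chains on the remaining simplices
(`FinsetChain.nonempty_homology_equiv`).
-/

/-! ### Boundary and cone operators on all finite vertex sets -/

namespace FinsetChain

variable {F V : Type*} [Field F]

/-- The chains on a family `L` of finite sets that have `q` vertices in each simplex. -/
def chains (F : Type*) [Field F] (L : Set (Finset V)) (q : ℕ) : Submodule F (Finset V →₀ F) :=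
  Finsupp.supported F F {s | s ∈ L ∧ s.card = q}

theorem single_mem_chains {L : Set (Finset V)} {q : ℕ} {s : Finset V} (hs : s ∈ L)
    (hq : s.card = q) (a : F) : Finsupp.single s a ∈ chains F L q :=
  Finsupp.single_mem_supported F a (by exact ⟨hs, hq⟩)

theorem chains_mono {L L' : Set (Finset V)} (h : L ⊆ L') (q : ℕ) : chains F L q ≤ chains F L' q :=
  Finsupp.supported_mono fun _ hs => ⟨h hs.1, hs.2⟩

theorem map_mem_of_forall_single {L : Set (Finset V)} {q : ℕ} {N : Submodule F (Finset V →₀ F)}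
    (f : (Finset V →₀ F) →ₗ[F] (Finset V →₀ F))
    (h : ∀ s ∈ L, s.card = q → f (Finsupp.single s 1) ∈ N) {x : Finset V →₀ F}
    (hx : x ∈ chains F L q) : f x ∈ N := by
  have : chains F L q ≤ N.comap f := by
    rw [chains, Finsupp.supported_eq_span_single, Submodule.span_le]
    rintro _ ⟨s, hs, rfl⟩
    exact h s hs.1 hs.2
  exact this hx

variable [LinearOrder V]

/-- The sign with which `v` enters or leaves the increasing list of the elements of `s`. -/
def sign (F : Type*) [Field F] (s : Finset V) (v : V) : F := (-1) ^ {u ∈ s | u < v}.card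

/-- The augmented simplicial boundary on formal combinations of all finite sets of vertices; the
empty set is the unique simplex of dimension `-1`, so homology here is reduced. -/
noncomputable def bdry (F V : Type*) [Field F] [LinearOrder V] :
    (Finset V →₀ F) →ₗ[F] (Finset V →₀ F) :=
  Finsupp.linearCombination F fun s => ∑ v ∈ s, Finsupp.single (s.erase v) (sign F s v)

/-- The cone operator with apex `v`: it adjoins `v` to the sets that do not contain it, and kills
the others. -/
noncomputable def cone (F : Type*) [Field F] (v : V) : (Finset V →₀ F) →ₗ[F] (Finset V →₀ F) :=
  Finsupp.linearCombination F fun s =>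
    if v ∈ s then 0 else Finsupp.single (insert v s) (sign F s v)

theorem bdry_single (s : Finset V) :
    bdry F V (Finsupp.single s 1) = ∑ v ∈ s, Finsupp.single (s.erase v) (sign F s v) := by
  simp [bdry]

theorem cone_single (v : V) (s : Finset V) (a : F) :
    cone F v (Finsupp.single s a) =
      if v ∈ s then 0 else Finsupp.single (insert v s) (a * sign F s v) := by
  simp only [cone, Finsupp.linearCombination_single]
  split_ifs <;> simp

theorem sign_mul_self (s : Finset V) (v : V) : sign F s v * sign F s v = 1 := by
  rw [sign, ← pow_add, ← two_mul, pow_mul]; simp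

theorem sign_insert_self (s : Finset V) (v : V) : sign F (insert v s) v = sign F s v := by
  simp [sign, Finset.filter_insert]

theorem sign_erase_self (s : Finset V) (v : V) : sign F (s.erase v) v = sign F s v := by
  rw [sign, sign, Finset.filter_erase, Finset.erase_eq_of_notMem (by simp)]

theorem sign_insert_of_lt {s : Finset V} {u v : V} (hv : v ∉ s) (h : v < u) :
    sign F (insert v s) u = -sign F s u := by
  rw [sign, sign, Finset.filter_insert, if_pos h, Finset.card_insert_of_notMem (by simp [hv]),
    pow_succ]
  ring

theorem sign_insert_of_gt {s : Finset V} {u v : V} (h : u < v) :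
    sign F (insert v s) u = sign F s u := by
  rw [sign, sign, Finset.filter_insert, if_neg h.not_gt]

theorem sign_insert_mul {s : Finset V} {u v : V} (hv : v ∉ s) (hu : u ∈ s) :
    sign F s v * sign F (insert v s) u = -(sign F s u * sign F (s.erase u) v) := by
  have hs : s = insert u (s.erase u) := (Finset.insert_erase hu).symm
  have huv : u ≠ v := fun h => hv (h ▸ hu)
  rcases lt_or_gt_of_ne huv with h | h
  · rw [sign_insert_of_gt h]
    nth_rewrite 1 [hs]
    rw [sign_insert_of_lt (Finset.notMem_erase _ _) h]; ring
  · rw [sign_insert_of_lt hv h]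
    nth_rewrite 1 [hs]
    rw [sign_insert_of_gt h]; ring

/-- The cone operator is a contraction of the full simplex: `∂ c + c ∂ = 1`. -/
theorem bdry_cone (v : V) (x : Finset V →₀ F) :
    bdry F V (cone F v x) = x - cone F v (bdry F V x) := by
  suffices h : bdry F V ∘ₗ cone F v + cone F v ∘ₗ bdry F V = LinearMap.id by
    rw [eq_sub_iff_add_eq]
    exact LinearMap.congr_fun h x
  refine Finsupp.lhom_ext' fun s => LinearMap.ext_ring ?_
  simp only [LinearMap.comp_apply, LinearMap.add_apply, Finsupp.lsingle_apply, LinearMap.id_apply]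
  rw [bdry_single, map_sum, cone_single]
  by_cases hv : v ∈ s
  · rw [if_pos hv, map_zero, zero_add, Finset.sum_eq_single_of_mem v hv]
    · rw [cone_single, if_neg (Finset.notMem_erase _ _), Finset.insert_erase hv, sign_erase_self,
        sign_mul_self]
    · intro u _ huv
      rw [cone_single, if_pos (Finset.mem_erase.mpr ⟨huv.symm, hv⟩)]
  · rw [if_neg hv, one_mul, ← mul_one (sign F s v), ← smul_eq_mul, ← Finsupp.smul_single, map_smul,
      bdry_single, Finset.sum_insert hv, Finset.erase_insert hv, sign_insert_self, smul_add,
      Finsupp.smul_single, smul_eq_mul, sign_mul_self, add_assoc, Finset.smul_sum,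
      ← Finset.sum_add_distrib, Finset.sum_eq_zero, add_zero]
    intro u hu
    have huv : u ≠ v := fun h => hv (h ▸ hu)
    rw [cone_single, if_neg (fun h => hv (Finset.mem_of_mem_erase h)),
      Finset.erase_insert_of_ne huv.symm, Finsupp.smul_single, smul_eq_mul, sign_insert_mul hv hu,
      ← Finsupp.single_add, neg_add_cancel, Finsupp.single_zero]

theorem bdry_bdry (x : Finset V →₀ F) : bdry F V (bdry F V x) = 0 := by
  suffices h : bdry F V ∘ₗ bdry F V = 0 from LinearMap.congr_fun h x
  refine Finsupp.lhom_ext' fun s => LinearMap.ext_ring ?_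
  simp only [LinearMap.comp_apply, Finsupp.lsingle_apply, LinearMap.zero_apply]
  induction s using Finset.induction_on with
  | empty => rw [bdry_single]; simp
  | insert v s hv ih =>
    -- A set containing `v` is, up to sign, a cone with apex `v`, and `∂∂c = c∂∂`.
    have hs : Finsupp.single (insert v s) (1 : F)
        = sign F s v • cone F v (Finsupp.single s 1) := by
      rw [cone_single, if_neg hv, one_mul, Finsupp.smul_single, smul_eq_mul, sign_mul_self]
    rw [hs, map_smul, map_smul, bdry_cone, map_sub, bdry_cone, ih, map_zero, sub_zero, sub_self,
      smul_zero]

theorem bdry_mem_chains {L L' : Set (Finset V)} {q : ℕ} {x : Finset V →₀ F}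
    (h : ∀ s ∈ L, ∀ v ∈ s, s.card = q + 1 → s.erase v ∈ L') (hx : x ∈ chains F L (q + 1)) :
    bdry F V x ∈ chains F L' q := by
  refine map_mem_of_forall_single _ (fun s hs hq => ?_) hx
  rw [bdry_single]
  refine Submodule.sum_mem _ fun v hv => single_mem_chains (h s hs v hv hq) ?_ _
  rw [Finset.card_erase_of_mem hv, hq]; rfl

/-! ### Acyclic families -/

/-- A family of finite sets is acyclic if each of its homogeneous cycles, in the augmented sense, is
a boundary within the family. -/
def Acyclic (F : Type*) [Field F] (L : Set (Finset V)) : Prop :=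
  ∀ q, ∀ y ∈ chains F L q, bdry F V y = 0 → ∃ w ∈ chains F L (q + 1), bdry F V w = y

theorem acyclic_empty : Acyclic F (∅ : Set (Finset V)) := by
  intro q y hy _
  refine ⟨0, zero_mem _, ?_⟩
  have : y = 0 := by simpa [chains] using hy
  rw [map_zero, this]

/-- The cone operator with apex `v`, restricted to the sets outside `L`. -/
noncomputable def coneOutside (F : Type*) [Field F] (L : Set (Finset V)) (v : V) :
    (Finset V →₀ F) →ₗ[F] (Finset V →₀ F) :=
  open Classical in
  Finsupp.linearCombination F fun s => if s ∈ L then 0 else cone F v (Finsupp.single s 1)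

theorem coneOutside_single_of_mem {L : Set (Finset V)} {s : Finset V} (hs : s ∈ L) (v : V)
    (a : F) : coneOutside F L v (Finsupp.single s a) = 0 := by
  simp [coneOutside, hs]

theorem coneOutside_single_of_notMem {L : Set (Finset V)} {s : Finset V} (hs : s ∉ L) (v : V)
    (a : F) : coneOutside F L v (Finsupp.single s a) = cone F v (Finsupp.single s a) := by
  simp only [coneOutside, Finsupp.linearCombination_single, if_neg hs]
  rw [← map_smul, Finsupp.smul_single, smul_eq_mul, mul_one]

/-- Adding to an acyclic complex `L` simplices that pair off by adjoining and removing one fixed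
vertex `v` gives an acyclic complex: up to chains on `L`, the cone operator on the new simplices is a
contracting homotopy, so a cycle on `L'` is a boundary plus a cycle on `L`. -/
theorem Acyclic.of_toggle {L L' : Set (Finset V)} (hL : Acyclic F L) (hsub : L ⊆ L')
    (hlow : IsLowerSet L) (hlow' : IsLowerSet L') (v : V)
    (hins : ∀ s ∈ L', s ∉ L → insert v s ∈ L') (hera : ∀ s ∈ L', s ∉ L → s.erase v ∉ L) :
    Acyclic F L' := by
  set h := coneOutside F L v with hh
  have key : ∀ q, ∀ x ∈ chains F L' q,
      bdry F V (h x) + h (bdry F V x) - x ∈ chains F L q := by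
    intro q x hx
    refine map_mem_of_forall_single (bdry F V ∘ₗ h + h ∘ₗ bdry F V - LinearMap.id) ?_ hx
    intro s hs hq
    simp only [LinearMap.comp_apply, LinearMap.add_apply, LinearMap.sub_apply, LinearMap.id_apply]
    by_cases hsL : s ∈ L
    · have h0 : h (bdry F V (Finsupp.single s 1)) = 0 := by
        rw [bdry_single, map_sum]
        exact Finset.sum_eq_zero fun u _ =>
          coneOutside_single_of_mem (hlow (Finset.erase_subset u s) hsL) v _
      rw [h0, hh, coneOutside_single_of_mem hsL, map_zero, add_zero, zero_sub]
      exact Submodule.neg_mem _ (single_mem_chains hsL hq _)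
    · rw [hh, coneOutside_single_of_notMem hsL, bdry_cone, ← hh, sub_add, sub_sub_cancel_left,
        neg_sub, bdry_single, map_sum, map_sum, ← Finset.sum_sub_distrib]
      refine Submodule.sum_mem _ fun u hu => ?_
      by_cases huL : s.erase u ∈ L
      · rw [hh, coneOutside_single_of_mem huL, zero_sub, cone_single]
        refine Submodule.neg_mem _ ?_
        split_ifs with hv
        · exact zero_mem _
        · -- Were this face outside `L`, so would be `s.erase u`, by removing `v` again.
          refine single_mem_chains ?_ ?_ _
          · by_contra hn
            refine hera (insert v (s.erase u)) ?_ hn ?_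
            · exact hlow' (Finset.insert_subset_insert v (Finset.erase_subset u s))
                (hins s hs hsL)
            · rwa [Finset.erase_insert hv]
          · rw [Finset.card_insert_of_notMem hv, Finset.card_erase_add_one hu, hq]
      · rw [hh, coneOutside_single_of_notMem huL, sub_self]
        exact zero_mem _
  intro q y hy hdy
  have hk := key q y hy
  rw [hdy, map_zero, add_zero] at hk
  obtain ⟨w, hw, hdw⟩ := hL q _ hk (by rw [map_sub, bdry_bdry, hdy, sub_zero])
  refine ⟨h y - w, Submodule.sub_mem _ ?_ (chains_mono hsub _ hw), ?_⟩
  · refine map_mem_of_forall_single h (fun s hs hq => ?_) hy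
    by_cases hsL : s ∈ L
    · rw [hh, coneOutside_single_of_mem hsL]; exact zero_mem _
    · rw [hh, coneOutside_single_of_notMem hsL, cone_single]
      split_ifs with hv
      · exact zero_mem _
      · exact single_mem_chains (hins s hs hsL) (by rw [Finset.card_insert_of_notMem hv, hq]) _
  · rw [map_sub, hdw, sub_sub_cancel]

/-! ### Homology of a complex relative to an acyclic subcomplex -/

section Comparison

open PreAbstractSimplicialComplex

variable {F V : Type*} [Field F] (K : PreAbstractSimplicialComplex V)

/-- The chains of a complex as combinations of finite sets of vertices. -/
noncomputable def ofChain (F : Type*) [Field F] (K : PreAbstractSimplicialComplex V) (i : ℕ) :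
    Chain F K i →ₗ[F] (Finset V →₀ F) :=
  Finsupp.lmapDomain F F fun s => s.1

theorem ofChain_single (i : ℕ) (s : K.Simplex i) (a : F) :
    ofChain F K i (Finsupp.single s a) = Finsupp.single s.1 a :=
  Finsupp.mapDomain_single

theorem ofChain_injective (i : ℕ) : Function.Injective (ofChain F K i) :=
  Finsupp.mapDomain_injective Subtype.val_injective

theorem range_ofChain (i : ℕ) : LinearMap.range (ofChain F K i) = chains F K.faces (i + 1) := by
  rw [ofChain, ← Submodule.map_top, ← Finsupp.supported_univ, Finsupp.lmapDomain_supported, chains,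
    Set.image_univ]
  congr 1
  exact Subtype.range_val

theorem ofChain_mem (i : ℕ) (c : Chain F K i) : ofChain F K i c ∈ chains F K.faces (i + 1) :=
  range_ofChain (F := F) K i ▸ LinearMap.mem_range_self _ c

theorem nonempty_subquotient_equiv {M N : Type*} [AddCommGroup M] [Module F M] [AddCommGroup N]
    [Module F N] {Z B : Submodule F M} (f : Z →ₗ[F] N) (hf : Function.Surjective f)
    (hker : LinearMap.ker f = B.submoduleOf Z) : Nonempty (Subquotient Z B ≃ₗ[F] N) :=
  ⟨show (Z ⧸ B.submoduleOf Z) ≃ₗ[F] N from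
    Submodule.quotEquivOfEq _ _ hker.symm ≪≫ₗ f.quotKerEquivOfSurjective hf⟩

variable [LinearOrder V]

theorem ofChain_boundary (i : ℕ) (c : Chain F K (i + 1)) :
    ofChain F K i (boundary F K i c) = bdry F V (ofChain F K (i + 1) c) := by
  suffices h : ofChain F K i ∘ₗ boundary F K i = bdry F V ∘ₗ ofChain F K (i + 1) from
    LinearMap.congr_fun h c
  refine Finsupp.lhom_ext' fun s => LinearMap.ext_ring ?_
  simp only [LinearMap.comp_apply, Finsupp.lsingle_apply, boundary,
    Finsupp.linearCombination_single, one_smul, map_sum, ofChain_single, bdry_single]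
  rw [← Finset.sum_attach s.1]
  rfl

variable {K}

/-- If an acyclic subcomplex `L` contains all simplices of `K` but those of a set `C`, and these
have the same dimension `i + 1`, then restriction of chains to `C` identifies the homology of `K`
in that dimension with the chains on `C`. Augmented cycles lift along the restriction, and cycles
that vanish on `C` bound, both because `L` is acyclic. -/
theorem nonempty_homology_equiv {L C : Set (Finset V)} {i : ℕ} (hL : Acyclic F L)
    (hlow : IsLowerSet L) (hLK : ∀ s ∈ L, s.Nonempty → s ∈ K.faces)
    (hC : ∀ s, s ∈ C ↔ s ∈ K.faces ∧ s ∉ L) (hcard : ∀ s ∈ C, s.card = i + 2) :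
    Nonempty (Homology F K (i + 1) ≃ₗ[F] (C →₀ F)) := by
  have hLchain : ∀ q, ∀ w ∈ chains F L (q + 1), ∃ c, ofChain F K q c = w := by
    intro q w hw
    rw [← LinearMap.mem_range, range_ofChain]
    exact fun s hs => ⟨hLK s (hw hs).1 (Finset.card_pos.mp (by rw [(hw hs).2]; omega)), (hw hs).2⟩
  -- Restriction of cycles to `C`.
  let f : cycles F K (i + 1) →ₗ[F] (C →₀ F) :=
    Finsupp.lsubtypeDomain C ∘ₗ ofChain F K (i + 1) ∘ₗ (cycles F K (i + 1)).subtype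
  have hf : ∀ z : cycles F K (i + 1), f z = (ofChain F K (i + 1) z.1).subtypeDomain (· ∈ C) :=
    fun _ => rfl
  have hzero : ∀ x ∈ chains F L (i + 2), x.subtypeDomain (· ∈ C) = 0 := by
    intro x hx
    ext s
    by_contra hne
    exact ((hC s.1).mp s.2).2 (hx (Finsupp.mem_support_iff.mpr hne)).1
  have hsurj : Function.Surjective f := by
    intro g
    have hx : g.embDomain (Function.Embedding.subtype _) ∈ chains F C (i + 2) := by
      intro s hs
      have hs' : s ∈ (g.embDomain (Function.Embedding.subtype (· ∈ C))).support := hs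
      rw [Finsupp.support_embDomain, Finset.mem_map] at hs'
      obtain ⟨t, -, rfl⟩ := hs'
      exact ⟨t.2, hcard _ t.2⟩
    set x := g.embDomain (Function.Embedding.subtype (· ∈ C)) with hxdef
    have hdx : bdry F V x ∈ chains F L (i + 1) := by
      refine bdry_mem_chains (fun s hs v hv hq => ?_) hx
      have hc : (s.erase v).card = i + 1 := by rw [Finset.card_erase_of_mem hv, hq]; rfl
      by_contra hn
      have : s.erase v ∈ C := (hC _).mpr ⟨(K.isRelLowerSet_faces ((hC s).mp hs).1).2
        (Finset.erase_subset _ _) (Finset.card_pos.mp (by omega)), hn⟩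
      have := hcard _ this
      omega
    obtain ⟨w, hw, hdw⟩ := hL _ _ hdx (bdry_bdry x)
    obtain ⟨b, hb⟩ := hLchain _ w hw
    have hxK : x ∈ LinearMap.range (ofChain F K (i + 1)) := by
      rw [range_ofChain]
      exact chains_mono (fun s hs => ((hC s).mp hs).1) _ hx
    obtain ⟨c, hc⟩ := hxK
    have hcyc : boundary F K i (c - b) = 0 := by
      apply ofChain_injective K i
      rw [ofChain_boundary, map_sub, map_sub, hb, hc, hdw, sub_self, map_zero]
    refine ⟨⟨c - b, hcyc⟩, ?_⟩
    rw [hf, map_sub, hb, hc]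
    ext s
    have h0 := DFunLike.congr_fun (hzero w hw) s
    simp only [Finsupp.subtypeDomain_apply, Finsupp.coe_zero, Pi.zero_apply] at h0
    simp only [Finsupp.subtypeDomain_apply, Finsupp.coe_sub, Pi.sub_apply, h0, sub_zero]
    exact Finsupp.embDomain_apply_self (Function.Embedding.subtype (· ∈ C)) g s
  have hker : LinearMap.ker f = (boundaries F K (i + 1)).submoduleOf (cycles F K (i + 1)) := by
    ext z
    rw [LinearMap.mem_ker, hf]
    change _ ↔ z.1 ∈ boundaries F K (i + 1)
    constructor
    · intro hz
      have hzL : ofChain F K (i + 1) z.1 ∈ chains F L (i + 2) := by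
        intro s hs
        have hsK := ofChain_mem K (i + 1) z.1 hs
        refine ⟨?_, hsK.2⟩
        by_contra hn
        exact Finsupp.mem_support_iff.mp hs
          (DFunLike.congr_fun hz (⟨s, (hC s).mpr ⟨hsK.1, hn⟩⟩ : C))
      have hdz : bdry F V (ofChain F K (i + 1) z.1) = 0 := by
        rw [← ofChain_boundary, show boundary F K i z.1 = 0 from z.2, map_zero]
      obtain ⟨w, hw, hdw⟩ := hL _ _ hzL hdz
      obtain ⟨b, rfl⟩ := hLchain _ w hw
      exact ⟨b, ofChain_injective K _ (by rw [ofChain_boundary, hdw])⟩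
    · rintro ⟨b, hb⟩
      rw [← hb, ofChain_boundary]
      refine hzero _ (bdry_mem_chains (L := K.faces) (fun s hs v hv hq => ?_)
        (ofChain_mem K (i + 2) b))
      refine hlow (Finset.erase_subset v s) ?_
      by_contra hn
      have := hcard s ((hC s).mpr ⟨hs, hn⟩)
      omega
  exact nonempty_subquotient_equiv f hsurj hker

end Comparison

end FinsetChain

/-! ### Joins of pairs of simplices matched by edges -/

section PairedJoin

variable {V : Type*} {k m : ℕ}

/-- The simplices, with the empty one, of the join over `j : Fin k` of the following graphs' clique
complexes: the vertices `p (j, i, true)` are pairwise adjacent, so are the vertices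
`p (j, i, false)`, and `p (j, i, true)` is adjacent to `p (j, i', false)` only for `i = i'`. -/
def pairedFaces (p : Fin k × Fin m × Bool → V) : Set (Finset V) :=
  {s | (∀ v ∈ s, ∃ x, p x = v) ∧
    ∀ j i i', p (j, i, true) ∈ s → p (j, i', false) ∈ s → i = i'}

theorem isLowerSet_pairedFaces (p : Fin k × Fin m × Bool → V) : IsLowerSet (pairedFaces p) :=
  fun _ _ hts hs => ⟨fun v hv => hs.1 v (hts hv), fun j i i' h h' => hs.2 j i i' (hts h) (hts h')⟩

theorem insert_mem_pairedFaces_true [DecidableEq V] {p : Fin k × Fin m × Bool → V}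
    (hp : Function.Injective p) {s : Finset V}
    (hs : s ∈ pairedFaces p) {j : Fin k} {i : Fin m} (h : ∀ i', p (j, i', false) ∈ s → i = i') :
    insert (p (j, i, true)) s ∈ pairedFaces p := by
  refine ⟨fun v hv => ?_, fun j' a b ha hb => ?_⟩
  · rcases Finset.mem_insert.mp hv with rfl | hv
    exacts [⟨_, rfl⟩, hs.1 v hv]
  · simp only [Finset.mem_insert, hp.eq_iff, Prod.mk.injEq] at ha hb
    rcases ha with ⟨rfl, rfl, -⟩ | ha <;> simp at hb
    exacts [h _ hb, hs.2 _ _ _ ha hb]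

theorem insert_mem_pairedFaces_false [DecidableEq V] {p : Fin k × Fin m × Bool → V}
    (hp : Function.Injective p) {s : Finset V}
    (hs : s ∈ pairedFaces p) {j : Fin k} {i : Fin m} (h : ∀ i', p (j, i', true) ∈ s → i' = i) :
    insert (p (j, i, false)) s ∈ pairedFaces p := by
  refine ⟨fun v hv => ?_, fun j' a b ha hb => ?_⟩
  · rcases Finset.mem_insert.mp hv with rfl | hv
    exacts [⟨_, rfl⟩, hs.1 v hv]
  · simp only [Finset.mem_insert, hp.eq_iff, Prod.mk.injEq] at ha hb
    rcases hb with ⟨rfl, rfl, -⟩ | hb <;> simp at ha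
    exacts [h _ ha, hs.2 _ _ _ ha hb]

variable [NeZero m]

/-- The `j`-th part of `s` contains a connecting edge other than the one with index `0`; in a
simplex it then consists of the two ends of this edge. -/
def HasEdge (p : Fin k × Fin m × Bool → V) (j : Fin k) (s : Finset V) : Prop :=
  ∃ i ≠ 0, p (j, i, true) ∈ s ∧ p (j, i, false) ∈ s

theorem HasEdge.mono {p : Fin k × Fin m × Bool → V} {j : Fin k} {s t : Finset V} (hst : s ⊆ t)
    (h : HasEdge p j s) : HasEdge p j t := by
  obtain ⟨i, hi, h1, h2⟩ := h
  exact ⟨i, hi, hst h1, hst h2⟩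

/-- The simplices with one of the first `t` parts not a connecting edge of nonzero index. -/
def edgeFreeFaces (p : Fin k × Fin m × Bool → V) (t : ℕ) : Set (Finset V) :=
  {s | s ∈ pairedFaces p ∧ ∃ j : Fin k, j.val < t ∧ ¬ HasEdge p j s}

theorem isLowerSet_edgeFreeFaces (p : Fin k × Fin m × Bool → V) (t : ℕ) :
    IsLowerSet (edgeFreeFaces p t) :=
  fun _ _ hts ⟨hs, j, hj, h⟩ => ⟨isLowerSet_pairedFaces p hts hs, j, hj, fun h' => h (h'.mono hts)⟩

theorem notMem_edgeFreeFaces {p : Fin k × Fin m × Bool → V} {t : ℕ} {s : Finset V}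
    (hs : s ∈ pairedFaces p) (h : s ∉ edgeFreeFaces p t) (j : Fin k) (hj : j.val < t) : HasEdge p j s := by
  by_contra hn
  exact h ⟨hs, j, hj, hn⟩

/-- The simplices in `edgeFreeFaces p j`, together with those whose `j`-th part spans a simplex with
`p (j, 0, true)`. -/
def starFaces [DecidableEq V] (p : Fin k × Fin m × Bool → V) (j : Fin k) : Set (Finset V) :=
  edgeFreeFaces p j ∪ {s | s ∈ pairedFaces p ∧ ∀ i, p (j, i, false) ∈ s → i = 0}

open FinsetChain

variable {F : Type*} [Field F] [LinearOrder V] {p : Fin k × Fin m × Bool → V}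

theorem isLowerSet_starFaces (p : Fin k × Fin m × Bool → V) (j : Fin k) :
    IsLowerSet (starFaces p j) :=
  (isLowerSet_edgeFreeFaces p j).union fun _ _ hts ⟨hs, h⟩ =>
    ⟨isLowerSet_pairedFaces p hts hs, fun i hi => h i (hts hi)⟩

theorem HasEdge.erase (hp : Function.Injective p) {s : Finset V} {j j' : Fin k} {b : Bool}
    (h : HasEdge p j s) : HasEdge p j (s.erase (p (j', 0, b))) := by
  obtain ⟨i, hi, h1, h2⟩ := h
  refine ⟨i, hi, ?_, ?_⟩ <;> simp [hp.eq_iff, hi, h1, h2]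

theorem erase_notMem_edgeFreeFaces (hp : Function.Injective p) {t : ℕ} {s : Finset V}
    (hs : s ∈ pairedFaces p) (h : s ∉ edgeFreeFaces p t) (j : Fin k) (b : Bool) :
    s.erase (p (j, 0, b)) ∉ edgeFreeFaces p t := by
  rintro ⟨-, j', hj', hn⟩
  exact hn ((notMem_edgeFreeFaces hs h j' hj').erase hp)

/-- The simplices added here pair off by toggling `p (j, 0, true)`, which affects none of the edges
in the parts before `j`. -/
theorem Acyclic.starFaces (hp : Function.Injective p) (j : Fin k)
    (h : Acyclic F (edgeFreeFaces p j)) : Acyclic F (starFaces p j) := by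
  refine h.of_toggle Set.subset_union_left (isLowerSet_edgeFreeFaces p j) (isLowerSet_starFaces p j)
    (p (j, 0, true)) ?_ ?_
  · rintro s (hs | ⟨hs, hj⟩) hsn
    · exact absurd hs hsn
    · refine Or.inr ⟨insert_mem_pairedFaces_true hp hs fun i hi => (hj i hi).symm, fun i hi => ?_⟩
      simp only [Finset.mem_insert, hp.eq_iff, Prod.mk.injEq] at hi
      exact hj i (by simpa using hi)
  · rintro s (hs | ⟨hs, hj⟩) hsn
    · exact absurd hs hsn
    · exact erase_notMem_edgeFreeFaces hp hs hsn j true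

theorem starFaces_subset (j : Fin k) : starFaces p j ⊆ edgeFreeFaces p (j + 1) := by
  rintro s (⟨hs, j', hj', hn⟩ | ⟨hs, h⟩)
  · exact ⟨hs, j', by omega, hn⟩
  · exact ⟨hs, j, by omega, fun ⟨i, hi, _, h2⟩ => hi (h i h2)⟩

/-- The `j`-th part of a simplex added here is a set of vertices `p (j, i, false)` with some `i ≠ 0`,
so these simplices pair off by toggling `p (j, 0, false)`. -/
theorem Acyclic.edgeFreeFaces_succ (hp : Function.Injective p) (j : Fin k)
    (h : Acyclic F (edgeFreeFaces p j)) : Acyclic F (edgeFreeFaces p (j + 1)) := by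
  refine (Acyclic.starFaces hp j h).of_toggle (starFaces_subset j) (isLowerSet_starFaces p j)
    (isLowerSet_edgeFreeFaces p _) (p (j, 0, false)) ?_ ?_
  all_goals
    intro s hs hsn
    have hsf : s ∉ edgeFreeFaces p j := fun h' => hsn (Or.inl h')
    have hnj : ¬ HasEdge p j s := by
      obtain ⟨hsp, j', hj', hn⟩ := hs
      rcases Nat.lt_succ_iff_lt_or_eq.mp hj' with hlt | heq
      · exact absurd (notMem_edgeFreeFaces hsp hsf j' hlt) hn
      · rwa [← Fin.ext heq]
    obtain ⟨i, his, hi⟩ : ∃ i, p (j, i, false) ∈ s ∧ i ≠ 0 := by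
      by_contra! hall
      exact hsn (Or.inr ⟨hs.1, hall⟩)
    -- The `j`-th part lies on the `false` side: a vertex on the other side would have index `i`.
    have hside : ∀ i', p (j, i', true) ∉ s := by
      intro i' hi'
      obtain rfl := hs.1.2 j i' i hi' his
      exact hnj ⟨i', hi, hi', his⟩
  · refine ⟨insert_mem_pairedFaces_false hp hs.1 fun i' hi' => absurd hi' (hside i'), j,
      by omega, ?_⟩
    rintro ⟨i', -, h1, -⟩
    simp only [Finset.mem_insert, hp.eq_iff, Prod.mk.injEq] at h1
    exact hside i' (by simpa using h1)
  · rintro (h1 | ⟨-, h1⟩)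
    · exact erase_notMem_edgeFreeFaces hp hs.1 hsf j false h1
    · exact hi (h1 i (by simp [hp.eq_iff, hi, his]))

theorem acyclic_edgeFreeFaces (hp : Function.Injective p) (t : ℕ) (ht : t ≤ k) :
    Acyclic F (edgeFreeFaces p t) := by
  induction t with
  | zero =>
    have : edgeFreeFaces p 0 = ∅ := by
      ext s; simp [edgeFreeFaces]
    rw [this]
    exact acyclic_empty
  | succ t ih => exact Acyclic.edgeFreeFaces_succ hp ⟨t, ht⟩ (ih (by omega))

/-- The simplex made of one connecting edge for each `j`. -/
def edgeFace (p : Fin k × Fin m × Bool → V) (f : Fin k → {i : Fin m // i ≠ 0}) : Finset V :=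
  Finset.univ.image fun x : Fin k × Bool => p (x.1, f x.1, x.2)

theorem mem_edgeFace (hp : Function.Injective p) {f : Fin k → {i : Fin m // i ≠ 0}} {j : Fin k}
    {i : Fin m} {b : Bool} : p (j, i, b) ∈ edgeFace p f ↔ i = f j := by
  simp only [edgeFace, Finset.mem_image, Finset.mem_univ, true_and, hp.eq_iff, Prod.mk.injEq,
    Prod.exists]
  constructor
  · rintro ⟨_, _, rfl, rfl, rfl⟩; rfl
  · rintro rfl; exact ⟨j, b, rfl, rfl, rfl⟩

theorem edgeFace_injective (hp : Function.Injective p) : Function.Injective (edgeFace p) := by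
  intro f g hfg
  funext j
  have h : p (j, (f j).1, true) ∈ edgeFace p g := hfg ▸ (mem_edgeFace hp).mpr rfl
  exact Subtype.ext ((mem_edgeFace hp).mp h)

theorem card_edgeFace (hp : Function.Injective p) (f : Fin k → {i : Fin m // i ≠ 0}) :
    (edgeFace p f).card = 2 * k := by
  rw [edgeFace, Finset.card_image_of_injective, Finset.card_univ]
  · simp [mul_comm]
  · intro x y hxy
    have := hp hxy
    simp only [Prod.mk.injEq] at this
    exact Prod.ext this.1 this.2.2

theorem mem_range_edgeFace (hp : Function.Injective p) {s : Finset V} :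
    s ∈ Set.range (edgeFace p) ↔ s ∈ pairedFaces p ∧ s ∉ edgeFreeFaces p k := by
  constructor
  · rintro ⟨f, rfl⟩
    refine ⟨⟨fun v hv => ?_, fun j i i' h h' => ?_⟩, fun ⟨_, j, _, hn⟩ => hn ?_⟩
    · obtain ⟨x, -, rfl⟩ := Finset.mem_image.mp hv
      exact ⟨_, rfl⟩
    · rw [(mem_edgeFace hp).mp h, (mem_edgeFace hp).mp h']
    · exact ⟨f j, (f j).2, (mem_edgeFace hp).mpr rfl, (mem_edgeFace hp).mpr rfl⟩
  · rintro ⟨hs, hn⟩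
    have hedge : ∀ j, HasEdge p j s := fun j => notMem_edgeFreeFaces hs hn j j.2
    choose f hf0 hft hff using hedge
    refine ⟨fun j => ⟨f j, hf0 j⟩, Finset.ext fun v => ⟨fun hv => ?_, fun hv => ?_⟩⟩
    · obtain ⟨⟨j, b⟩, -, rfl⟩ := Finset.mem_image.mp hv
      cases b
      exacts [hff j, hft j]
    · obtain ⟨⟨j, i, b⟩, rfl⟩ := hs.1 v hv
      rw [mem_edgeFace hp]
      cases b
      exacts [(hs.2 j _ _ (hft j) hv).symm, hs.2 j _ _ hv (hff j)]

/-- The homology of the join has a basis indexed by the choices of a connecting edge of nonzero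
index in each of the `k` factors. -/
theorem nonempty_homology_equiv_of_faces_eq (hp : Function.Injective p) (hk : 0 < k)
    {K : PreAbstractSimplicialComplex V}
    (hK : ∀ s, s ∈ K.faces ↔ s.Nonempty ∧ s ∈ pairedFaces p) :
    Nonempty (PreAbstractSimplicialComplex.Homology F K (2 * k - 1) ≃ₗ[F]
      ((Fin k → {i : Fin m // i ≠ 0}) →₀ F)) := by
  obtain ⟨i, hi⟩ : ∃ i, 2 * k = i + 2 := ⟨2 * k - 2, by omega⟩
  rw [show 2 * k - 1 = i + 1 by omega]
  have hcard : ∀ s ∈ Set.range (edgeFace p), s.card = i + 2 := by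
    rintro _ ⟨f, rfl⟩
    rw [card_edgeFace hp, hi]
  have hC : ∀ s, s ∈ Set.range (edgeFace p) ↔ s ∈ K.faces ∧ s ∉ edgeFreeFaces p k := by
    intro s
    rw [hK]
    refine ⟨fun hs => ⟨⟨?_, ((mem_range_edgeFace hp).mp hs).1⟩, ((mem_range_edgeFace hp).mp hs).2⟩,
      fun hs => (mem_range_edgeFace hp).mpr ⟨hs.1.2, hs.2⟩⟩
    exact Finset.card_pos.mp (by rw [hcard s hs]; omega)
  obtain ⟨e⟩ := nonempty_homology_equiv (K := K) (acyclic_edgeFreeFaces (F := F) hp k le_rfl)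
    (isLowerSet_edgeFreeFaces p k) (fun s hs hne => (hK s).mpr ⟨hne, hs.1⟩) hC hcard
  exact ⟨e ≪≫ₗ Finsupp.domLCongr (Equiv.ofInjective _ (edgeFace_injective hp)).symm⟩

end PairedJoin

/-! ### Distances between the rotated points -/

section RotatedPoints

open Real

theorem dist_planeRotation_sq (φ ψ a y b z : ℝ) :
    dist (planeRotation φ !₂[a, y]) (planeRotation ψ !₂[b, z]) ^ 2 =
      a ^ 2 + y ^ 2 + b ^ 2 + z ^ 2
        - 2 * ((a * b + y * z) * cos (φ - ψ) + (a * z - y * b) * sin (φ - ψ)) := by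
  rw [EuclideanSpace.dist_eq, Real.sq_sqrt (by positivity), Fin.sum_univ_two]
  simp only [planeRotation, Real.dist_eq, sq_abs, PiLp.toLp_apply, Matrix.cons_val_zero,
    Matrix.cons_val_one]
  rw [cos_sub, sin_sub]
  linear_combination (a ^ 2 + y ^ 2) * sin_sq_add_cos_sq φ + (b ^ 2 + z ^ 2) * sin_sq_add_cos_sq ψ

/-- The point of the rotated set with rotation index `j`, height index `i` and side `b`, where
`true` stands for the abscissa `1/2`. Heights are counted from `0`. -/
noncomputable def rotatedPoint (k m : ℕ) (δ : ℝ) (x : Fin k × Fin m × Bool) :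
    EuclideanSpace ℝ (Fin 2) :=
  planeRotation ((x.1 : ℕ) * (π / k))
    !₂[if x.2.2 then 1 / 2 else -1 / 2, ((x.2.1 + 1 : ℕ) : ℝ) * δ]

theorem range_rotatedPoint (k m : ℕ) (δ : ℝ) :
    Set.range (rotatedPoint k m δ) = rotatedPoints k m δ := by
  ext q
  constructor
  · rintro ⟨⟨j, i, b⟩, rfl⟩
    refine ⟨j, j.2, _, ⟨i + 1, by omega, i.2, ?_⟩, rfl⟩
    cases b
    exacts [Or.inr (by simp), Or.inl (by simp)]
  · rintro ⟨j, hj, _, ⟨i, hi, him, rfl | rfl⟩, rfl⟩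
    · exact ⟨(⟨j, hj⟩, ⟨i - 1, by omega⟩, true), by simp [rotatedPoint, Nat.sub_add_cancel hi]⟩
    · exact ⟨(⟨j, hj⟩, ⟨i - 1, by omega⟩, false), by simp [rotatedPoint, Nat.sub_add_cancel hi]⟩

theorem abs_cos_le_of_mem {α β : ℝ} (h0 : 0 ≤ β) (h1 : β ≤ α) (h2 : α ≤ π - β) :
    |cos α| ≤ cos β := by
  rw [abs_le, ← cos_pi_sub]
  exact ⟨cos_le_cos_of_nonneg_of_le_pi (by linarith) (by linarith) h2,
    cos_le_cos_of_nonneg_of_le_pi h0 (by linarith) h1⟩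

/-- Two different rotation angles keep a distance of at least `π / k` from each other modulo `π`. -/
theorem abs_cos_sub_le {k j j' : ℕ} (hj : j < k) (hj' : j' < k) (hne : j ≠ j') :
    |cos (j * (π / k) - j' * (π / k))| ≤ cos (π / k) := by
  wlog hlt : j' < j generalizing j j'
  · rw [← cos_neg, neg_sub]
    exact this hj' hj hne.symm (by omega)
  have hk : (0 : ℝ) < k := by exact_mod_cast (by omega : 0 < k)
  have hπ : 0 < π / k := by positivity
  have h1 : (j' : ℝ) + 1 ≤ j := by exact_mod_cast hlt
  have h2 : (j : ℝ) + 1 ≤ k := by exact_mod_cast hj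
  have h3 : (0 : ℝ) ≤ j' := Nat.cast_nonneg _
  have hπk : k * (π / k) = π := by field_simp
  refine abs_cos_le_of_mem hπ.le ?_ ?_ <;> nlinarith

/-- The Jordan inequality gives `1 - cos (π / k) = 2 sin² (π / 2k) ≥ 2 / k²`. -/
theorem two_div_sq_le_one_sub_cos {k : ℕ} (hk : 2 ≤ k) :
    2 / (k : ℝ) ^ 2 ≤ 1 - cos (π / k) := by
  have hk' : (2 : ℝ) ≤ k := by exact_mod_cast hk
  have hk0 : (0 : ℝ) < k := by linarith
  have h1 : π / k / 2 ≤ π / 2 := by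
    have : π / k ≤ π := div_le_self pi_pos.le (by linarith)
    linarith
  have h := mul_le_sin (x := π / k / 2) (by positivity) h1
  have h2 : 2 / π * (π / k / 2) = 1 / k := by field_simp
  rw [h2] at h
  have h3 : cos (π / k) = 1 - 2 * sin (π / k / 2) ^ 2 := by
    have h4 := cos_two_mul (π / k / 2)
    rw [show 2 * (π / k / 2) = π / k by ring] at h4
    linarith [sin_sq_add_cos_sq (π / k / 2)]
  have h5 : (1 / (k : ℝ)) ^ 2 ≤ sin (π / k / 2) ^ 2 := by gcongr
  rw [h3, show 2 / (k : ℝ) ^ 2 = 2 * (1 / (k : ℝ)) ^ 2 by ring]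
  linarith

/-- Points `(±1/2, y)` and `(±1/2, z)` rotated by different angles are distinct and at distance at
most `1` if their heights are small against `1 / k²`: the squared distance is
`(1 ± cos α) / 2` up to terms of the order of the heights, where `|cos α| ≤ 1 - 2 / k²`. -/
theorem dist_rotated_of_ne {k j j' : ℕ} (hj : j < k) (hj' : j' < k) (hne : j ≠ j')
    {a b y z Y : ℝ} (ha : a ^ 2 = 1 / 4) (hb : b ^ 2 = 1 / 4) (hy : 0 ≤ y) (hyY : y ≤ Y)
    (hz : 0 ≤ z) (hzY : z ≤ Y) (hY : Y ≤ 1 / (16 * (k : ℝ) ^ 2)) :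
    dist (planeRotation (j * (π / k)) !₂[a, y]) (planeRotation (j' * (π / k)) !₂[b, z]) ≤ 1 ∧
    0 < dist (planeRotation (j * (π / k)) !₂[a, y]) (planeRotation (j' * (π / k)) !₂[b, z]) := by
  have hk : 2 ≤ k := by omega
  have hc := abs_cos_sub_le hj hj' hne
  have hJ := two_div_sq_le_one_sub_cos hk
  have hd := dist_planeRotation_sq (j * (π / k)) (j' * (π / k)) a y b z
  set D := dist (planeRotation (j * (π / k)) !₂[a, y]) (planeRotation (j' * (π / k)) !₂[b, z])
  set c := cos (j * (π / k) - j' * (π / k))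
  set s := sin (j * (π / k) - j' * (π / k))
  have hs1 : |s| ≤ 1 := abs_sin_le_one _
  have hc1 : |c| ≤ 1 := abs_cos_le_one _
  have hk1 : (4 : ℝ) ≤ (k : ℝ) ^ 2 := by
    have : (2 : ℝ) ≤ k := by exact_mod_cast hk
    nlinarith
  have hr : 1 / (16 * (k : ℝ) ^ 2) = (2 / (k : ℝ) ^ 2) / 32 := by field_simp; norm_num
  have hr1 : 2 / (k : ℝ) ^ 2 ≤ 1 / 2 := by
    rw [div_le_div_iff₀ (by linarith) (by norm_num)]; linarith
  rw [hr] at hY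
  set r := 2 / (k : ℝ) ^ 2
  have ha' : |a| = 1 / 2 := by
    rw [← sqrt_sq_eq_abs, ha, show (1 / 4 : ℝ) = (1 / 2) ^ 2 by norm_num, sqrt_sq (by norm_num)]
  have hb' : |b| = 1 / 2 := by
    rw [← sqrt_sq_eq_abs, hb, show (1 / 4 : ℝ) = (1 / 2) ^ 2 by norm_num, sqrt_sq (by norm_num)]
  have hab : |a * b * c| ≤ (1 - r) / 4 := by
    rw [abs_mul, abs_mul, ha', hb']; linarith
  have hY0 : 0 ≤ Y := hy.trans hyY
  have hyz : |y * z * c| ≤ Y * Y := by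
    rw [abs_mul, abs_of_nonneg (mul_nonneg hy hz), ← mul_one (Y * Y)]
    gcongr
  have hcross : |(a * z - y * b) * s| ≤ Y := by
    have h1 : |a * z - y * b| ≤ Y := by
      refine (abs_sub _ _).trans ?_
      rw [abs_mul, abs_mul, ha', hb', abs_of_nonneg hy, abs_of_nonneg hz]
      linarith
    rw [abs_mul, ← mul_one Y]
    gcongr
  have hY1 : Y * Y ≤ Y := by nlinarith
  have hyy : y ^ 2 ≤ Y * Y := by rw [sq]; gcongr
  have hzz : z ^ 2 ≤ Y * Y := by rw [sq]; gcongr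
  have hr0 : 0 < r := by positivity
  have hD : D ^ 2 = 1 / 2 + y ^ 2 + z ^ 2 - 2 * (a * b * c) - 2 * (y * z * c)
      - 2 * ((a * z - y * b) * s) := by
    linear_combination hd + ha + hb
  rw [abs_le] at hab hyz hcross
  constructor
  · rw [← sq_le_one_iff₀ dist_nonneg, hD]
    linarith
  · refine lt_of_le_of_ne dist_nonneg fun h0 => ?_
    rw [← h0] at hD
    linarith [sq_nonneg y, sq_nonneg z]

theorem dist_rotatedPoint_of_ne {k m : ℕ} {δ : ℝ} (hδ : 0 ≤ δ) (h : m * δ ≤ 1 / (16 * (k : ℝ) ^ 2))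
    {x x' : Fin k × Fin m × Bool} (hne : x.1 ≠ x'.1) :
    dist (rotatedPoint k m δ x) (rotatedPoint k m δ x') ≤ 1 ∧
      0 < dist (rotatedPoint k m δ x) (rotatedPoint k m δ x') := by
  have hle : ∀ i : Fin m, ((i + 1 : ℕ) : ℝ) * δ ≤ m * δ := fun i => by
    gcongr
    exact i.2
  refine dist_rotated_of_ne x.1.2 x'.1.2 (fun h => hne (Fin.ext h)) ?_ ?_ (by positivity)
    (hle x.2.1) (by positivity) (hle x'.2.1) h <;>
  split_ifs <;> norm_num

theorem dist_rotatedPoint_sq_of_eq {k m : ℕ} {δ : ℝ} (j : Fin k) (i i' : Fin m) (b b' : Bool) :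
    dist (rotatedPoint k m δ (j, i, b)) (rotatedPoint k m δ (j, i', b')) ^ 2 =
      (if b = b' then 0 else 1) + (((i : ℝ) - i') * δ) ^ 2 := by
  rw [rotatedPoint, rotatedPoint, dist_planeRotation_sq, sub_self, cos_zero, sin_zero]
  push_cast
  cases b <;> cases b' <;> simp only [reduceIte, reduceCtorEq, Bool.false_eq_true] <;> ring

theorem rotatedPoint_injective {k m : ℕ} {δ : ℝ} (hδ : 0 < δ)
    (h : m * δ ≤ 1 / (16 * (k : ℝ) ^ 2)) : Function.Injective (rotatedPoint k m δ) := by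
  rintro ⟨j, i, b⟩ ⟨j', i', b'⟩ heq
  obtain rfl : j = j' := by
    by_contra hne
    have := (dist_rotatedPoint_of_ne hδ.le h (x := (j, i, b)) (x' := (j', i', b')) hne).2
    rw [heq, dist_self] at this
    exact this.false
  have hd := dist_rotatedPoint_sq_of_eq (δ := δ) j i i' b b'
  rw [heq, dist_self] at hd
  have hb : b = b' := by
    by_contra hne
    rw [if_neg hne] at hd
    nlinarith [sq_nonneg (((i : ℝ) - i') * δ)]
  rw [if_pos hb] at hd
  have h0 : ((i : ℝ) - i') * δ = 0 := by
    rw [← sq_eq_zero_iff]; linarith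
  have hi : (i : ℝ) = i' := by
    rcases mul_eq_zero.mp h0 with h0 | h0 <;> linarith
  rw [hb, Fin.ext (Nat.cast_injective hi)]

theorem dist_rotatedPoint_le_one_iff {k m : ℕ} {δ : ℝ} (hδ : 0 < δ)
    (h : m * δ ≤ 1 / (16 * (k : ℝ) ^ 2)) {j j' : Fin k} {i i' : Fin m} {b b' : Bool} :
    dist (rotatedPoint k m δ (j, i, b)) (rotatedPoint k m δ (j', i', b')) ≤ 1 ↔
      (j = j' → b ≠ b' → i = i') := by
  by_cases hj : j = j'
  · subst hj
    rw [← sq_le_one_iff₀ dist_nonneg, dist_rotatedPoint_sq_of_eq]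
    by_cases hb : b = b'
    · have hk : (1 : ℝ) ≤ k := by exact_mod_cast (by have := j.2; omega : 1 ≤ k)
      have hmδ : m * δ ≤ 1 := by
        refine h.trans ((div_le_one (by positivity)).mpr ?_)
        nlinarith
      have h1 : |((i : ℝ) - i') * δ| ≤ 1 := by
        rw [abs_mul, abs_of_pos hδ]
        refine le_trans (mul_le_mul_of_nonneg_right ?_ hδ.le) hmδ
        have h2 : (i : ℝ) < m := by exact_mod_cast i.2
        have h3 : (i' : ℝ) < m := by exact_mod_cast i'.2
        have h4 : (0 : ℝ) ≤ i := Nat.cast_nonneg _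
        have h5 : (0 : ℝ) ≤ i' := Nat.cast_nonneg _
        rw [abs_le]
        constructor <;> linarith
      simpa [hb] using h1
    · rw [if_neg hb]
      constructor
      · intro hle _ _
        have h0 : (((i : ℝ) - i') * δ) ^ 2 = 0 :=
          le_antisymm (by linarith) (sq_nonneg _)
        rcases mul_eq_zero.mp (sq_eq_zero_iff.mp h0) with h0 | h0
        · exact Fin.ext (Nat.cast_injective (sub_eq_zero.mp h0))
        · exact absurd h0 hδ.ne'
      · intro hi
        rw [hi rfl hb]
        simp
  · exact iff_of_true (dist_rotatedPoint_of_ne hδ.le h hj).1 fun h' => absurd h' hj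

theorem mem_faces_ripsComplex_rotatedPoints {k m : ℕ} {δ : ℝ} (hδ : 0 < δ)
    (h : m * δ ≤ 1 / (16 * (k : ℝ) ^ 2)) (s : Finset (EuclideanSpace ℝ (Fin 2))) :
    s ∈ (ripsComplex 1 (rotatedPoints k m δ)).faces ↔
      s.Nonempty ∧ s ∈ pairedFaces (rotatedPoint k m δ) := by
  rw [← range_rotatedPoint]
  refine and_congr_right fun _ => and_congr_right fun hs => ⟨fun hd j i i' hi hi' => ?_,
    fun hd v hv w hw => ?_⟩
  · exact (dist_rotatedPoint_le_one_iff hδ h).mp (hd _ hi _ hi') rfl (by simp)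
  · obtain ⟨⟨j, i, b⟩, rfl⟩ := hs hv
    obtain ⟨⟨j', i', b'⟩, rfl⟩ := hs hw
    rw [dist_rotatedPoint_le_one_iff hδ h]
    rintro rfl hb
    cases b <;> cases b'
    exacts [absurd rfl hb, (hd j i' i hw hv).symm, hd j i i' hv hw, absurd rfl hb]

end RotatedPoints

/-- The linear order on the plane is arbitrary; it only serves to orient the simplices. -/
theorem proposition3 (F : Type*) [Field F] [LinearOrder (EuclideanSpace ℝ (Fin 2))]
    (k m n : ℕ) (hk : 0 < k) (hm : 0 < m) (hn : n = 2 * k * m) :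
    Module.Finite F (PreAbstractSimplicialComplex.Homology F
        (ripsComplex 1 (rotatedPoints k m (1 / (n : ℝ) ^ 4))) (2 * k - 1)) ∧
    (PreAbstractSimplicialComplex.betti F
        (ripsComplex 1 (rotatedPoints k m (1 / (n : ℝ) ^ 4))) (2 * k - 1) : ℝ)
        = ((m : ℝ) - 1) ^ k ∧
    (PreAbstractSimplicialComplex.betti F
        (ripsComplex 1 (rotatedPoints k m (1 / (n : ℝ) ^ 4))) (2 * k - 1) : ℝ)
        = ((n : ℝ) / (2 * k) - 1) ^ k := by
  have : NeZero m := ⟨hm.ne'⟩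
  have hk' : (1 : ℝ) ≤ k := by exact_mod_cast hk
  have hm' : (1 : ℝ) ≤ m := by exact_mod_cast hm
  have hn' : (n : ℝ) = 2 * k * m := by rw [hn]; push_cast; ring
  have hδ : 0 < 1 / (n : ℝ) ^ 4 := by rw [hn']; positivity
  have hsmall : m * (1 / (n : ℝ) ^ 4) ≤ 1 / (16 * (k : ℝ) ^ 2) := by
    rw [hn', mul_one_div, div_le_div_iff₀ (by positivity) (by positivity)]
    have h1 : (k : ℝ) ^ 2 ≤ k ^ 4 := pow_le_pow_right₀ hk' (by norm_num)
    have h2 : (m : ℝ) ≤ m ^ 4 := le_self_pow₀ hm' (by norm_num)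
    have h3 : (m : ℝ) * k ^ 2 ≤ m ^ 4 * k ^ 4 := by gcongr
    linarith
  obtain ⟨e⟩ := nonempty_homology_equiv_of_faces_eq (F := F) (rotatedPoint_injective hδ hsmall) hk
    (mem_faces_ripsComplex_rotatedPoints hδ hsmall)
  have hbetti : (PreAbstractSimplicialComplex.betti F
      (ripsComplex 1 (rotatedPoints k m (1 / (n : ℝ) ^ 4))) (2 * k - 1) : ℝ)
      = ((m : ℝ) - 1) ^ k := by
    rw [PreAbstractSimplicialComplex.betti, e.finrank_eq, Module.finrank_finsupp_self,
      Fintype.card_fun, Fintype.card_fin, Fintype.card_subtype_compl, Fintype.card_fin,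
      Fintype.card_subtype_eq]
    push_cast [Nat.cast_sub (show 1 ≤ m from hm)]
    rfl
  refine ⟨Module.Finite.equiv e.symm, hbetti, ?_⟩
  rw [hbetti, hn', mul_div_cancel_left₀ _ (by positivity)]
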